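/- Let $\alpha,\beta:\mathbb{R}\to(0,\infty)$ have bounded variation, with $\inf_{\mathbb{R}}\alpha>0$ and $\inf_{\mathbb{R}}\beta>0$, and suppose there are $R_0,\alpha_0,\beta_0>0$ such that $\alpha(x)=\alpha_0$ and $\beta(x)=\beta_0$ for $|x|\ge R_0$. Let $\mathcal H=L^2(\mathbb{R};\beta(x)\,dx)$ be the complex Hilbert space with inner product $\langle u,v\rangle_{\mathcal H}=\int_{\mathbb{R}}\overline{u}\,v\,\beta\,dx$, and let $H$ be the operator in $\mathcal H$ given by $$Hu=-\beta^{-1}\partial_x(\alpha\,\partial_x u),\qquad \mathcal D(H)=\{u\in L^2(\mathbb{R}) : u,\partial_xu\in L^2(\mathbb{R})\cap L^\infty(\mathbb{R}),\ \partial_x(\alpha\,\partial_xu)\in L^2(\mathbb{R})\},$$ where the derivatives are taken in the sense of distributions. Then $H$ has a unique nonnegative self-adjoint square root $H^{1/2}$ (the unique nonnegative self-adjoint operator $A$ in $\mathcal H$ with $A^2=H$, where $A^2$ has domain $\{u\in\mathcal D(A): Au\in\mathcal D(A)\}$). Its domain is the Sobolev space $$\mathcal D(H^{1/2})=H^1(\mathbb{R})=\{u\in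 L^2(\mathbb{R}) : \partial_xu\in L^2(\mathbb{R})\},$$ and on it the norms $\|u\|_{H^1}=(\|u\|_{L^2}^2+\|\partial_xu\|_{L^2}^2)^{1/2}$ and $(\|u\|_{\mathcal H}^2+\|H^{1/2}u\|_{\mathcal H}^2)^{1/2}$ are equivalent: there are constants $c,C>0$ (depending only on $\alpha,\beta$) such that $$c\,\|u\|_{H^1}\le\big(\|u\|_{\mathcal H}^2+\|H^{1/2}u\|_{\mathcal H}^2\big)^{1/2}\le C\,\|u\|_{H^1}\qquad\text{for all }u\in\mathcal D(H^{1/2}).$$ -/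

import Mathlib

open MeasureTheory Set
open scoped ENNReal ContDiff

noncomputable section

namespace BVWave

/-! ### Weak derivatives and the Sobolev space `H¹(ℝ)` -/

/-- `g` is the weak (distributional) derivative of `f` on `ℝ`. -/
def HasWeakDeriv (f g : ℝ → ℂ) : Prop :=
  LocallyIntegrable f volume ∧ LocallyIntegrable g volume ∧
    ∀ φ : ℝ → ℝ, ContDiff ℝ ∞ φ → HasCompactSupport φ →
      ∫ x, deriv φ x • f x = -∫ x, φ x • g x

theorem HasWeakDeriv.congr_ae {f g f' g' : ℝ → ℂ} (h : HasWeakDeriv f g)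
    (hf : f =ᵐ[volume] f') (hg : g =ᵐ[volume] g') : HasWeakDeriv f' g' := by
  refine ⟨(locallyIntegrable_congr hf).1 h.1, (locallyIntegrable_congr hg).1 h.2.1,
    fun φ hφ hc => ?_⟩
  have e1 : ∫ x, deriv φ x • f' x = ∫ x, deriv φ x • f x :=
    integral_congr_ae (hf.mono fun x hx => by simp only [hx])
  have e2 : ∫ x, φ x • g' x = ∫ x, φ x • g x :=
    integral_congr_ae (hg.mono fun x hx => by simp only [hx])
  rw [e1, e2]
  exact h.2.2 φ hφ hc

/-- Weak derivatives are unique up to null sets. -/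
theorem HasWeakDeriv.unique {f g g' : ℝ → ℂ} (h : HasWeakDeriv f g) (h' : HasWeakDeriv f g') :
    g =ᵐ[volume] g' := by
  refine ae_eq_of_integral_contDiff_smul_eq h.2.1 h'.2.1 fun φ hφ hc => ?_
  have h1 := h.2.2 φ hφ hc
  rw [h'.2.2 φ hφ hc] at h1
  exact (neg_injective h1).symm

theorem HasWeakDeriv.zero : HasWeakDeriv 0 0 :=
  ⟨locallyIntegrable_zero, locallyIntegrable_zero, fun φ _ _ => by simp⟩

theorem HasWeakDeriv.add {f g f' g' : ℝ → ℂ} (h : HasWeakDeriv f g) (h' : HasWeakDeriv f' g') :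
    HasWeakDeriv (f + f') (g + g') := by
  refine ⟨h.1.add h'.1, h.2.1.add h'.2.1, fun φ hφ hc => ?_⟩
  have hd : Continuous (deriv φ) := hφ.continuous_deriv (by simp)
  simp only [Pi.add_apply, smul_add]
  rw [integral_add (h.1.integrable_smul_left_of_hasCompactSupport hd hc.deriv)
      (h'.1.integrable_smul_left_of_hasCompactSupport hd hc.deriv),
    integral_add (h.2.1.integrable_smul_left_of_hasCompactSupport hφ.continuous hc)
      (h'.2.1.integrable_smul_left_of_hasCompactSupport hφ.continuous hc),
    h.2.2 φ hφ hc, h'.2.2 φ hφ hc, neg_add]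

theorem HasWeakDeriv.smul {f g : ℝ → ℂ} (c : ℂ) (h : HasWeakDeriv f g) :
    HasWeakDeriv (c • f) (c • g) := by
  refine ⟨h.1.smul c, h.2.1.smul c, fun φ hφ hc => ?_⟩
  simp only [Pi.smul_apply, smul_comm _ c]
  rw [integral_smul, integral_smul, h.2.2 φ hφ hc, smul_neg]

open scoped Classical in
/-- A weak derivative of `f` (unique almost everywhere), and `0` if there is none. -/
def weakDeriv (f : ℝ → ℂ) : ℝ → ℂ :=
  if h : ∃ g, HasWeakDeriv f g then h.choose else 0

theorem HasWeakDeriv.weakDeriv_ae_eq {f g : ℝ → ℂ} (h : HasWeakDeriv f g) :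
    weakDeriv f =ᵐ[volume] g := by
  have h' : ∃ g, HasWeakDeriv f g := ⟨g, h⟩
  rw [weakDeriv, dif_pos h']
  exact h'.choose_spec.unique h

/-- Membership in the Sobolev space `H¹(ℝ)`: `f` and its weak derivative are in `L²(ℝ)`. -/
def MemH1 (f : ℝ → ℂ) : Prop :=
  MemLp f 2 volume ∧ ∃ g, HasWeakDeriv f g ∧ MemLp g 2 volume

/-- The Sobolev norm `(‖f‖² + ‖f'‖²)^{1/2}`, with the norms of `L²(ℝ)`. -/
def h1Norm (f : ℝ → ℂ) : ℝ :=
  Real.sqrt ((eLpNorm f 2 volume).toReal ^ 2 + (eLpNorm (weakDeriv f) 2 volume).toReal ^ 2)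

/-! ### Square roots of unbounded operators -/

section Operators

variable {E : Type*} [NormedAddCommGroup E] [InnerProductSpace ℂ E] [CompleteSpace E]

/-- `A` is a nonnegative self-adjoint operator (in particular densely defined) with `A² = T`,
where `A²` has its natural domain `{u ∈ D(A) : A u ∈ D(A)}`. -/
structure IsNonnegSqrt (T A : E →ₗ.[ℂ] E) : Prop where
  selfAdjoint : IsSelfAdjoint A
  nonneg : ∀ u : A.domain, 0 ≤ (inner ℂ (u : E) (A u)).re
  sq_eq : ∀ u w : E, (u, w) ∈ T.graph ↔ ∃ v, (u, v) ∈ A.graph ∧ (v, w) ∈ A.graph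

open scoped Classical in
/-- The square root `T^{1/2}`: the nonnegative self-adjoint operator whose square is `T`
(and, as a default, the zero operator if there is none). -/
def opSqrt (T : E →ₗ.[ℂ] E) : E →ₗ.[ℂ] E :=
  if h : ∃ A, IsNonnegSqrt T A then h.choose else 0

/-- The graph norm `(‖u‖² + ‖A u‖²)^{1/2}` on the domain of `A`. -/
def graphNorm (A : E →ₗ.[ℂ] E) (u : A.domain) : ℝ :=
  Real.sqrt (‖(u : E)‖ ^ 2 + ‖A u‖ ^ 2)

end Operators

/-! ### The operator `H = -β⁻¹ ∂ₓ(α ∂ₓ ·)` -/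

/-- The measure `β(x) dx`. -/
def weight (β : ℝ → ℝ) : Measure ℝ :=
  volume.withDensity fun x => ENNReal.ofReal (β x)

/-- The complex Hilbert space `L²(ℝ; β(x) dx)`. -/
abbrev WeightedL2 (β : ℝ → ℝ) : Type := Lp ℂ 2 (weight β)

/-- The graph of `H`: the pairs `(u, H u)` with `u, ∂ₓu ∈ L² ∩ L^∞`, `∂ₓ(α ∂ₓu) ∈ L²` and
`H u = -β⁻¹ ∂ₓ(α ∂ₓu)`. Here `f` represents the class `u`, `v = ∂ₓ f` and `g = ∂ₓ(α v)`. -/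
def waveGraph (α β : ℝ → ℝ) : Submodule ℂ (WeightedL2 β × WeightedL2 β) where
  carrier := {p | ∃ f v g : ℝ → ℂ, p.1 =ᵐ[weight β] f ∧
    MemLp f 2 volume ∧ MemLp f ∞ volume ∧
    HasWeakDeriv f v ∧ MemLp v 2 volume ∧ MemLp v ∞ volume ∧
    HasWeakDeriv (fun x => (α x : ℂ) * v x) g ∧ MemLp g 2 volume ∧
    p.2 =ᵐ[weight β] fun x => -((β x : ℂ)⁻¹ * g x)}
  zero_mem' := by
    refine ⟨0, 0, 0, Lp.coeFn_zero _ _ _, MemLp.zero, MemLp.zero, HasWeakDeriv.zero, MemLp.zero,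
      MemLp.zero, ?_, MemLp.zero, ?_⟩
    · convert HasWeakDeriv.zero using 1
      ext x; simp
    · filter_upwards [Lp.coeFn_zero ℂ 2 (weight β)] with x hx
      simpa using hx
  add_mem' := by
    rintro p q ⟨f, v, g, h1, h2, h3, h4, h5, h6, h7, h8, h9⟩
      ⟨f', v', g', h1', h2', h3', h4', h5', h6', h7', h8', h9'⟩
    refine ⟨f + f', v + v', g + g', (Lp.coeFn_add _ _).trans (h1.add h1'), h2.add h2',
      h3.add h3', h4.add h4', h5.add h5', h6.add h6', ?_, h8.add h8', ?_⟩
    · convert h7.add h7' using 1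
      ext x; simp [mul_add]
    · filter_upwards [Lp.coeFn_add p.2 q.2, h9, h9'] with x hx hx1 hx2
      simp only [Prod.snd_add, hx, Pi.add_apply, hx1, hx2]
      ring
  smul_mem' := by
    rintro c p ⟨f, v, g, h1, h2, h3, h4, h5, h6, h7, h8, h9⟩
    refine ⟨c • f, c • v, c • g, (Lp.coeFn_smul _ _).trans (h1.const_smul c), h2.const_smul c,
      h3.const_smul c, h4.smul c, h5.const_smul c, h6.const_smul c, ?_, h8.const_smul c, ?_⟩
    · convert h7.smul c using 1
      ext x; simp [mul_left_comm]
    · filter_upwards [Lp.coeFn_smul c p.2, h9] with x hx hx1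
      simp only [Prod.smul_snd, hx, Pi.smul_apply, hx1, smul_eq_mul]
      ring

/-- The operator `H u = -β⁻¹ ∂ₓ(α ∂ₓu)` in `L²(ℝ; β(x) dx)`, with domain
`{u ∈ L² : u, ∂ₓu ∈ L² ∩ L^∞, ∂ₓ(α ∂ₓu) ∈ L²}`. -/
def waveOp (α β : ℝ → ℝ) : WeightedL2 β →ₗ.[ℂ] WeightedL2 β :=
  (waveGraph α β).toLinearPMap

/-- For a positive measurable `β` the graph of `waveOp α β` is indeed `waveGraph α β`. -/
theorem waveOp_graph (α β : ℝ → ℝ) (hβ : AEMeasurable β volume) (hβ_pos : ∀ x, 0 < β x) :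
    (waveOp α β).graph = waveGraph α β := by
  have hac : volume ≪ weight β :=
    withDensity_absolutelyContinuous' hβ.ennreal_ofReal (ae_of_all _ fun x => by simp [hβ_pos x])
  refine Submodule.toLinearPMap_graph_eq _ ?_
  rintro ⟨u, w⟩ ⟨f, v, g, h1, -, -, h4, -, -, h7, -, h9⟩ hu
  obtain rfl : u = 0 := hu
  have hf : f =ᵐ[volume] 0 := hac.ae_le (h1.symm.trans (Lp.coeFn_zero _ _ _))
  have hv : v =ᵐ[volume] 0 :=
    (h4.congr_ae hf Filter.EventuallyEq.rfl).unique HasWeakDeriv.zero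
  have hg : g =ᵐ[volume] 0 := by
    refine (h7.congr_ae ?_ Filter.EventuallyEq.rfl).unique HasWeakDeriv.zero
    filter_upwards [hv] with x hx
    simp [hx]
  refine Lp.ext (h9.trans ?_)
  filter_upwards [Lp.coeFn_zero ℂ 2 (weight β),
    (withDensity_absolutelyContinuous volume fun x => ENNReal.ofReal (β x)).ae_le hg] with x hx hx1
  rw [hx, hx1]
  simp

end BVWave

end

/-! `H` is the operator of the closed form `∫ α ū' v'` with form domain `H¹(ℝ)`. Give `H¹(ℝ)` the
norm `‖u‖² + ∫ α |u'|²`, and let `J` be its embedding into `L²(β dx)`: an injective contraction with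
dense range. Tested against `H¹(ℝ)`, the equation `H u = w` says exactly `u = J J† (u + w)`, so `J
J† = (1 + H)⁻¹` (`mem_waveGraph_iff`). The `L^∞` conditions in the domain of `H` are automatic,
since `u` and `α u'` are in `H¹(ℝ)`.

The rest is abstract (`exists_isNonnegSqrt`). Put `R = J J†`, `S = R^{1/2}` and `C = (1 - R)^{1/2}`.
These are commuting bounded operators with `S² + C² = 1`, and `A = C S⁻¹` is a nonnegative
self-adjoint square root of `R⁻¹ - 1`. If `B` is another, then `B R` is a bounded nonnegative
operator with square `R - R²`, hence equals `S C`; this forces `B = A`. By polar decomposition `J =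
S U` with `U` unitary, so the domain of `A` is the range of `J`, and `‖S y‖² + ‖C y‖² = ‖y‖²` turns
the graph norm of `A` into the form norm. The latter is comparable to the `H¹` norm because `α` and
`β` lie between positive constants. -/

noncomputable section

namespace BVWave

/-! ### Abstract theory: the square root of `R⁻¹ - 1` for a bounded operator `R` -/

section AbstractSqrt

variable {E : Type*} [NormedAddCommGroup E] [InnerProductSpace ℂ E]

/-! ### Quotients of bounded operators -/

/-- For injective `S`, the operator `C S⁻¹` with domain the range
of `S`. -/
def quotOp (S C : E →L[ℂ] E) : E →ₗ.[ℂ] E :=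
  (LinearMap.range ((S : E →ₗ[ℂ] E).prod (C : E →ₗ[ℂ] E))).toLinearPMap

theorem mem_graph_quotOp {S : E →L[ℂ] E} (C : E →L[ℂ] E) (hS : Function.Injective S) (u v : E) :
    (u, v) ∈ (quotOp S C).graph ↔ ∃ y, S y = u ∧ C y = v := by
  have : (quotOp S C).graph = LinearMap.range ((S : E →ₗ[ℂ] E).prod (C : E →ₗ[ℂ] E)) := by
    refine Submodule.toLinearPMap_graph_eq _ ?_
    rintro ⟨a, b⟩ ⟨y, hy⟩ ha
    obtain ⟨h1, h2⟩ := Prod.mk_inj.1 hy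
    have : y = 0 := hS (by simpa using h1.trans ha)
    rw [← h2, this]
    simp
  rw [this]
  simp [LinearMap.mem_range, Prod.ext_iff]

theorem mem_domain_quotOp {S : E →L[ℂ] E} (C : E →L[ℂ] E) (hS : Function.Injective S) (u : E) :
    u ∈ (quotOp S C).domain ↔ ∃ y, S y = u := by
  rw [LinearPMap.mem_domain_iff]
  simp only [mem_graph_quotOp C hS]
  exact ⟨fun ⟨_, y, h, _⟩ => ⟨y, h⟩, fun ⟨y, h⟩ => ⟨C y, y, h, rfl⟩⟩

variable [CompleteSpace E]

/-! ### Self-adjoint operators through their graphs -/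

/-- The right-hand side spells out that the graph equals its own adjoint graph. In this form no
domain subtypes occur in later arguments. -/
theorem isSelfAdjoint_iff_graph {A : E →ₗ.[ℂ] E} (hA : Dense (A.domain : Set E)) :
    IsSelfAdjoint A ↔ ∀ u v : E, (u, v) ∈ A.graph ↔
      ∀ a b : E, (a, b) ∈ A.graph → inner ℂ b u = inner ℂ a v := by
  rw [LinearPMap.isSelfAdjoint_def]
  constructor
  · intro h u v
    have hg := LinearPMap.adjoint_graph_eq_graph_adjoint hA
    rw [h] at hg
    nth_rw 1 [hg]
    rw [Submodule.mem_adjoint_iff]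
    simp only [sub_eq_zero]
  · intro h
    refine LinearPMap.eq_of_eq_graph ?_
    rw [LinearPMap.adjoint_graph_eq_graph_adjoint hA]
    ext ⟨u, v⟩
    rw [h u v, Submodule.mem_adjoint_iff]
    simp only [sub_eq_zero]

theorem mem_graph_iff_of_isSelfAdjoint {A : E →ₗ.[ℂ] E} (hA : IsSelfAdjoint A) (u v : E) :
    (u, v) ∈ A.graph ↔ ∀ a b : E, (a, b) ∈ A.graph → inner ℂ b u = inner ℂ a v :=
  (isSelfAdjoint_iff_graph hA.dense_domain).1 hA u v

theorem inner_eq_of_mem_graph {A : E →ₗ.[ℂ] E} (hA : IsSelfAdjoint A) {u v u' v' : E}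
    (h : (u, v) ∈ A.graph) (h' : (u', v') ∈ A.graph) : inner ℂ v u' = inner ℂ u v' :=
  (mem_graph_iff_of_isSelfAdjoint hA u' v').1 h' u v h

/-! ### Existence and uniqueness of the square root -/

theorem denseRange_of_orthogonal {F : Type*} [AddCommGroup F] [Module ℂ F] {L : F →ₗ[ℂ] E}
    (h : ∀ x, (∀ y, inner ℂ (L y) x = 0) → x = 0) : DenseRange L := by
  have h' : (LinearMap.range L)ᗮ = ⊥ :=
    (Submodule.eq_bot_iff _).2 fun x hx => h x fun y => hx (L y) ⟨y, rfl⟩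
  have := (Submodule.topologicalClosure_eq_top_iff).2 h'
  exact (Submodule.dense_iff_topologicalClosure_eq_top).2 this

theorem denseRange_of_isSelfAdjoint {S : E →L[ℂ] E} (hS : IsSelfAdjoint S)
    (hinj : Function.Injective S) : DenseRange S := by
  refine denseRange_of_orthogonal (L := (S : E →ₗ[ℂ] E)) fun x hx => hinj ?_
  rw [map_zero]
  refine ext_inner_left ℂ fun y => ?_
  rw [inner_zero_right, ← hx y]
  exact ((ContinuousLinearMap.isSelfAdjoint_iff_isSymmetric.1 hS) y x).symm

variable {R S C : E →L[ℂ] E}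

/-- Symmetry comes from `S` and `C` commuting. Conversely, a pair `(u, v)` in the adjoint graph
satisfies `C u = S v`, and `S² + C² = 1` then recovers the parameter. -/
theorem quotOp_isSelfAdjoint (hS : IsSelfAdjoint S) (hC : IsSelfAdjoint C) (hSC : Commute S C)
    (hone : S * S + C * C = 1) (hinj : Function.Injective S) : IsSelfAdjoint (quotOp S C) := by
  have sS := ContinuousLinearMap.isSelfAdjoint_iff_isSymmetric.1 hS
  have sC := ContinuousLinearMap.isSelfAdjoint_iff_isSymmetric.1 hC
  have hcomm : ∀ x, S (C x) = C (S x) := fun x => DFunLike.congr_fun hSC.eq x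
  have hone' : ∀ x, S (S x) + C (C x) = x := fun x => DFunLike.congr_fun hone x
  have hdense : Dense ((quotOp S C).domain : Set E) := by
    have : ((quotOp S C).domain : Set E) = range S := Set.ext fun u => mem_domain_quotOp C hinj u
    rw [this]
    exact denseRange_of_isSelfAdjoint hS hinj
  rw [isSelfAdjoint_iff_graph hdense]
  intro u v
  simp only [mem_graph_quotOp C hinj]
  constructor
  · rintro ⟨y, rfl, rfl⟩ _ _ ⟨z, rfl, rfl⟩
    calc inner ℂ (C z) (S y) = inner ℂ (S (C z)) y := (sS _ _).symm
      _ = inner ℂ (C (S z)) y := by rw [hcomm]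
      _ = _ := sC _ _
  · intro h
    have hCv : C u = S v := by
      refine ext_inner_left ℂ fun y => ?_
      calc inner ℂ y (C u) = inner ℂ (C y) u := (sC _ _).symm
        _ = inner ℂ (S y) v := h _ _ ⟨y, rfl, rfl⟩
        _ = _ := sS _ _
    -- If `u = S y` and `v = C y`, then `S u + C v = (S² + C²) y = y`; this dictates the witness.
    refine ⟨S u + C v, ?_, ?_⟩
    · rw [map_add, hcomm, ← hCv, hone']
    · rw [map_add, ← hcomm, hCv, hone']

theorem quotOp_isNonnegSqrt {T : E →ₗ.[ℂ] E} (hS : IsSelfAdjoint S) (hC : IsSelfAdjoint C)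
    (hSC : Commute S C) (hpos : 0 ≤ S * C) (hSS : S * S = R) (hone : S * S + C * C = 1)
    (hinj : Function.Injective S) (hT : ∀ u w, (u, w) ∈ T.graph ↔ u = R (u + w)) :
    IsNonnegSqrt T (quotOp S C) := by
  have sS := ContinuousLinearMap.isSelfAdjoint_iff_isSymmetric.1 hS
  have hcomm : ∀ x, S (C x) = C (S x) := fun x => DFunLike.congr_fun hSC.eq x
  have hone' : ∀ x, S (S x) + C (C x) = x := fun x => DFunLike.congr_fun hone x
  have hSS' : ∀ x, R x = S (S x) := fun x => (DFunLike.congr_fun hSS x).symm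
  refine ⟨quotOp_isSelfAdjoint hS hC hSC hone hinj, ?_, ?_⟩
  · intro u
    obtain ⟨y, hy, hy'⟩ := (mem_graph_quotOp C hinj _ _).1 ((quotOp S C).mem_graph u)
    rw [← hy, ← hy']
    have h := ((ContinuousLinearMap.nonneg_iff_isPositive _).1 hpos).re_inner_nonneg_right y
    have e : inner ℂ (S y) (C y) = inner ℂ y ((S * C) y) := sS _ _
    rw [e]
    exact h
  · intro u w
    simp only [hT, mem_graph_quotOp C hinj, hSS']
    constructor
    · intro h
      -- With `x = u + w` the chain is `u = S² x`, `A u = C S x = S C x`, `A² u = C² x = x - u = w`.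
      refine ⟨_, ⟨S (u + w), h.symm, rfl⟩, C (u + w), hcomm _, ?_⟩
      have := hone' (u + w)
      rw [← h] at this
      exact add_left_cancel this
    · rintro ⟨_, ⟨y, rfl, rfl⟩, z, hz, rfl⟩
      rw [map_add, hcomm z, hz, hone']

/-- The uniqueness part: every nonnegative self-adjoint square root is `C S⁻¹`. -/
theorem eq_quotOp_of_isNonnegSqrt {T B : E →ₗ.[ℂ] E} (hS : IsSelfAdjoint S) (hC : IsSelfAdjoint C)
    (hSC : Commute S C) (hpos : 0 ≤ S * C) (hSS : S * S = R) (hone : S * S + C * C = 1)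
    (hinj : Function.Injective S) (hT : ∀ u w, (u, w) ∈ T.graph ↔ u = R (u + w))
    (hB : IsNonnegSqrt T B) : B = quotOp S C := by
  have sS := ContinuousLinearMap.isSelfAdjoint_iff_isSymmetric.1 hS
  have hcomm : ∀ x, S (C x) = C (S x) := fun x => DFunLike.congr_fun hSC.eq x
  have hSS' : ∀ x, R x = S (S x) := fun x => (DFunLike.congr_fun hSS x).symm
  have sB := fun {u v u' v' : E} => inner_eq_of_mem_graph (u := u) (v := v) (u' := u') (v' := v')
    hB.selfAdjoint
  have nB : ∀ {u v : E}, (u, v) ∈ B.graph → 0 ≤ (inner ℂ v u).re := by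
    intro u v h
    obtain ⟨y, rfl, rfl⟩ := (LinearPMap.mem_graph_iff _).1 h
    have := hB.nonneg y
    rwa [← inner_conj_symm, Complex.conj_re]
  have uB : ∀ {u v v' : E}, (u, v) ∈ B.graph → (u, v') ∈ B.graph → v = v' := fun h h' =>
    B.mem_graph_snd_inj h h' rfl
  -- Since `T (R x) = x - R x`, the vector `k x = B R x` is defined for every `x`, and `B (k x) = x
  -- - R x`.
  have key : ∀ x, ∃ v, (R x, v) ∈ B.graph ∧ (v, x - R x) ∈ B.graph := fun x =>
    (hB.sq_eq _ _).1 ((hT _ _).2 (by rw [add_sub_cancel]))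
  choose k hk hk' using key
  let K₀ : E →ₗ[ℂ] E :=
    { toFun := k
      map_add' := fun x y => uB (hk _) (by
        have := B.graph.add_mem (hk x) (hk y); rwa [Prod.mk_add_mk, ← map_add] at this)
      map_smul' := fun c x => uB (hk _) (by
        have := B.graph.smul_mem c (hk x); rwa [Prod.smul_mk, ← map_smul] at this) }
  have K₀s : K₀.IsSymmetric := by
    intro x y
    change inner ℂ (k x) y = inner ℂ x (k y)
    have h1 := sB (hk x) (hk y)
    have h2 := sB (hk' x) (hk' y)
    calc inner ℂ (k x) y = inner ℂ (k x) (R y) + inner ℂ (k x) (y - R y) := by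
          rw [← inner_add_right, add_sub_cancel]
      _ = inner ℂ (R x) (k y) + inner ℂ (x - R x) (k y) := by rw [h1, ← h2]
      _ = _ := by rw [← inner_add_left, add_sub_cancel]
  -- Hellinger–Toeplitz: an everywhere defined symmetric operator is bounded.
  let K : E →L[ℂ] E := ⟨K₀, K₀s.continuous⟩
  have hKpos : 0 ≤ K := by
    rw [ContinuousLinearMap.nonneg_iff_isPositive, ContinuousLinearMap.isPositive_def]
    refine ⟨K₀s, fun x => ?_⟩
    change 0 ≤ (inner ℂ (k x) x).re
    have h1 := nB (hk x)
    have h2 := nB (hk' x)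
    rw [← inner_conj_symm, Complex.conj_re] at h2
    have : inner ℂ (k x) x = inner ℂ (k x) (R x) + inner ℂ (k x) (x - R x) := by
      rw [← inner_add_right, add_sub_cancel]
    rw [this, Complex.add_re]
    exact add_nonneg h1 h2
  have hKK : K * K = R - R * R := by
    ext x
    change k (k x) = R x - R (R x)
    -- This gives `k (R x) = R (k x)`, so `k (k x) = B R (k x) = B (k (R x)) = R x - R (R x)`.
    have h1 : (k (R x), k x - k (R x)) ∈ T.graph := by
      refine (hB.sq_eq _ _).2 ⟨R x - R (R x), hk' (R x), ?_⟩
      have := B.graph.sub_mem (hk x) (hk (R x))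
      rwa [Prod.mk_sub_mk] at this
    have h2 := (hT _ _).1 h1
    rw [add_sub_cancel] at h2
    have h3 := hk (k x)
    rw [← h2] at h3
    exact uB h3 (hk' (R x))
  have hSCSC : (S * C) * (S * C) = R - R * R := by
    have : C * C = 1 - R := by rw [← hone, hSS]; abel
    calc (S * C) * (S * C) = (S * S) * (C * C) := by
          rw [mul_assoc, ← mul_assoc C, ← hSC.eq, mul_assoc S C, mul_assoc S S]
      _ = _ := by rw [this, hSS, mul_sub, mul_one]
  -- Both are nonnegative with square `R - R²`, and nonnegative square roots of bounded operators
  -- are unique.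
  have hKeq : K = S * C := by
    rw [← CFC.sqrt_unique hKK hKpos, ← CFC.sqrt_unique hSCSC hpos]
  -- For `y = S x` this is `B R x = S C x`. The range of `S` is dense and the adjoint relation
  -- passes to limits, so it holds for all `y`.
  have hle : ∀ y, (S y, C y) ∈ B.graph := by
    intro y
    rw [mem_graph_iff_of_isSelfAdjoint hB.selfAdjoint]
    intro a b hab
    have hcont1 : Continuous fun y => inner ℂ b (S y) := by fun_prop
    have hcont2 : Continuous fun y => inner ℂ a (C y) := by fun_prop
    refine congrFun (DenseRange.equalizer (denseRange_of_isSelfAdjoint hS hinj) hcont1 hcont2 ?_) y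
    funext x
    have h1 := hk x
    have h2 : k x = C (S x) := (DFunLike.congr_fun hKeq x).trans (hcomm x)
    rw [hSS', h2] at h1
    exact sB hab h1
  refine LinearPMap.eq_of_eq_graph ?_
  ext ⟨u, v⟩
  constructor
  · intro h
    -- `B` extends `C S⁻¹`; a self-adjoint operator has no proper symmetric extension.
    rw [mem_graph_iff_of_isSelfAdjoint (quotOp_isSelfAdjoint hS hC hSC hone hinj)]
    intro a b hab
    obtain ⟨y, rfl, rfl⟩ := (mem_graph_quotOp C hinj _ _).1 hab
    exact sB (hle y) h
  · intro h
    obtain ⟨y, rfl, rfl⟩ := (mem_graph_quotOp C hinj _ _).1 h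
    exact hle y

/-- If `J : G → E` is an injective contraction with dense range and `T = (J J†)⁻¹ - 1`, then `T` has
exactly one nonnegative self-adjoint square root. Its domain is the range of `J`, and its graph norm
is the norm of `G`. -/
theorem exists_isNonnegSqrt {G : Type*} [NormedAddCommGroup G] [InnerProductSpace ℂ G]
    [CompleteSpace G] (J : G →L[ℂ] E) (hJ : Function.Injective J) (hJd : DenseRange J)
    (hJ1 : ∀ g, ‖J g‖ ≤ ‖g‖) {T : E →ₗ.[ℂ] E}
    (hT : ∀ u w, (u, w) ∈ T.graph ↔ u = J (J.adjoint (u + w))) :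
    ∃ A, IsNonnegSqrt T A ∧ (∀ B, IsNonnegSqrt T B → B = A) ∧ (∀ u, u ∈ A.domain ↔ ∃ g, J g = u) ∧
      ∀ g (h : J g ∈ A.domain), graphNorm A ⟨J g, h⟩ = ‖g‖ := by
  let R : E →L[ℂ] E := J ∘L J.adjoint
  have hRpos : 0 ≤ R := (ContinuousLinearMap.nonneg_iff_isPositive _).2
    (ContinuousLinearMap.isPositive_self_comp_adjoint J)
  have hRinner : ∀ x, inner ℂ (R x) x = inner ℂ (J.adjoint x) (J.adjoint x) := fun x =>
    (ContinuousLinearMap.adjoint_inner_right J _ _).symm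
  have hJ1' : ‖J‖ ≤ 1 := J.opNorm_le_bound zero_le_one (by simpa using hJ1)
  have hR1 : 0 ≤ 1 - R := by
    rw [ContinuousLinearMap.nonneg_iff_isPositive, ContinuousLinearMap.isPositive_def']
    refine ⟨(IsSelfAdjoint.one _).sub (.of_nonneg hRpos), fun x => ?_⟩
    have h2 : ‖J.adjoint x‖ ≤ ‖x‖ := by
      refine (J.adjoint.le_opNorm x).trans ?_
      rw [LinearIsometryEquiv.norm_map]
      exact mul_le_of_le_one_left (norm_nonneg _) hJ1'
    have : ContinuousLinearMap.reApplyInnerSelf (1 - R) x = ‖x‖ ^ 2 - ‖J.adjoint x‖ ^ 2 := by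
      rw [ContinuousLinearMap.reApplyInnerSelf_apply, sub_apply, inner_sub_left,
        hRinner, map_sub, inner_self_eq_norm_sq, one_apply_eq_self,
        inner_self_eq_norm_sq]
    rw [this, sub_nonneg]
    gcongr
  have hJadj_inj : Function.Injective J.adjoint := by
    refine (injective_iff_map_eq_zero _).2 fun x hx => ?_
    refine hJd.eq_zero_of_inner_left ℂ (fun g => ?_)
    rw [← ContinuousLinearMap.adjoint_inner_left, hx, inner_zero_left]
  let S := CFC.sqrt R
  let C := CFC.sqrt (1 - R)
  have hSpos : 0 ≤ S := CFC.sqrt_nonneg R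
  have hCpos : 0 ≤ C := CFC.sqrt_nonneg _
  have hSS : S * S = R := CFC.sqrt_mul_sqrt_self R
  have hCC : C * C = 1 - R := CFC.sqrt_mul_sqrt_self _
  have hSC : Commute S C := by
    have h1 : Commute (1 - R) S :=
      ((Commute.one_left S).sub_left (Commute.cfcₙ_nnreal (Commute.refl R) _).symm)
    exact (Commute.cfcₙ_nnreal h1 _).symm
  have hpos : 0 ≤ S * C := hSC.mul_nonneg hSpos hCpos
  have hone : S * S + C * C = 1 := by rw [hSS, hCC]; abel
  have hS : IsSelfAdjoint S := .of_nonneg hSpos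
  have hC : IsSelfAdjoint C := .of_nonneg hCpos
  have sS := ContinuousLinearMap.isSelfAdjoint_iff_isSymmetric.1 hS
  have sC := ContinuousLinearMap.isSelfAdjoint_iff_isSymmetric.1 hC
  have hSS' : ∀ x, S (S x) = J (J.adjoint x) := fun x => DFunLike.congr_fun hSS x
  have hinj : Function.Injective S := by
    refine (injective_iff_map_eq_zero _).2 fun x hx => hJadj_inj (hJ ?_)
    rw [← hSS', hx]
    simp
  have hnorm : ∀ x, ‖S x‖ = ‖J.adjoint x‖ := by
    intro x
    have h1 : inner ℂ (S x) (S x) = inner ℂ (J.adjoint x) (J.adjoint x) := by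
      rw [← hRinner, ← hSS]
      exact (sS (S x) x).symm
    rw [@norm_eq_sqrt_re_inner ℂ, h1, ← @norm_eq_sqrt_re_inner ℂ]
  have hnorm1 : ∀ y, ‖S y‖ ^ 2 + ‖C y‖ ^ 2 = ‖y‖ ^ 2 := by
    intro y
    have h1 : inner ℂ (S y) (S y) + inner ℂ (C y) (C y) = inner ℂ y y := by
      have e1 : inner ℂ (S y) (S y) = inner ℂ y (S (S y)) := sS _ _
      have e2 : inner ℂ (C y) (C y) = inner ℂ y (C (C y)) := sC _ _
      rw [e1, e2, ← inner_add_right]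
      congr 1
      exact DFunLike.congr_fun hone y
    rw [← @inner_self_eq_norm_sq ℂ, ← @inner_self_eq_norm_sq ℂ, ← map_add, h1,
      @inner_self_eq_norm_sq ℂ]
  have hSd : DenseRange S := denseRange_of_isSelfAdjoint hS hinj
  have hJad : DenseRange J.adjoint := by
    refine denseRange_of_orthogonal (L := (J.adjoint : E →ₗ[ℂ] G)) fun x hx => hJ ?_
    rw [map_zero]
    refine ext_inner_left ℂ fun y => ?_
    rw [inner_zero_right, ← hx y]
    exact (ContinuousLinearMap.adjoint_inner_left J _ _).symm
  -- Polar decomposition: as `‖S x‖ = ‖J† x‖`, the maps `J† x ↦ S x` and `S x ↦ J† x` extend from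
  -- dense ranges to isometries `U` and `V`. Then `S U = J` and `J V = S`, so `S` and `J` have the
  -- same range.
  have hU0 : ∃ D, ∀ x, ‖S x‖ ≤ D * ‖J.adjoint x‖ := ⟨1, fun x => by rw [hnorm, one_mul]⟩
  have hV0 : ∃ D, ∀ x, ‖J.adjoint x‖ ≤ D * ‖S x‖ := ⟨1, fun x => by rw [hnorm, one_mul]⟩
  let U : G →L[ℂ] E := LinearMap.extendOfNorm (S : E →ₗ[ℂ] E) (J.adjoint : E →ₗ[ℂ] G)
  let V : E →L[ℂ] G := LinearMap.extendOfNorm (J.adjoint : E →ₗ[ℂ] G) (S : E →ₗ[ℂ] E)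
  have hU : ∀ x, U (J.adjoint x) = S x := LinearMap.extendOfNorm_eq hJad hU0
  have hV : ∀ x, V (S x) = J.adjoint x := LinearMap.extendOfNorm_eq hSd hV0
  have hSU : ∀ g, S (U g) = J g := congrFun (hJad.equalizer (by fun_prop) (by fun_prop)
    (funext fun x => by simp only [Function.comp_apply, hU, hSS']))
  have hJV : ∀ y, J (V y) = S y := congrFun (hSd.equalizer (by fun_prop) (by fun_prop)
    (funext fun x => by simp only [Function.comp_apply, hV, hSS']))
  have hUn : ∀ g, ‖U g‖ = ‖g‖ := congrFun (hJad.equalizer (by fun_prop) (by fun_prop)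
    (funext fun x => by simp only [Function.comp_apply, hU, hnorm]))
  refine ⟨quotOp S C, quotOp_isNonnegSqrt hS hC hSC hpos hSS hone hinj hT,
    fun B hB => eq_quotOp_of_isNonnegSqrt hS hC hSC hpos hSS hone hinj hT hB, fun u => ?_,
    fun g h => ?_⟩
  · rw [mem_domain_quotOp C hinj]
    exact ⟨fun ⟨y, hy⟩ => ⟨V y, (hJV y).trans hy⟩, fun ⟨g, hg⟩ => ⟨U g, (hSU g).trans hg⟩⟩
  · obtain ⟨y, hy, hy'⟩ := (mem_graph_quotOp C hinj _ _).1 ((quotOp S C).mem_graph ⟨J g, h⟩)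
    have : y = U g := hinj (hy.trans (hSU g).symm)
    rw [graphNorm, ← hy', ← hy, hnorm1, this, hUn, Real.sqrt_sq (norm_nonneg _)]

end AbstractSqrt

/-! ### Primitives of locally integrable functions -/

/-- `F` is the (locally absolutely continuous) primitive of the locally integrable function `f`. -/
def IsPrimitive (F f : ℝ → ℂ) : Prop :=
  LocallyIntegrable f volume ∧ ∀ x, F x = F 0 + ∫ t in (0 : ℝ)..x, f t

theorem intervalIntegrable_of_locallyIntegrable {f : ℝ → ℂ} (hf : LocallyIntegrable f volume)
    (a b : ℝ) : IntervalIntegrable f volume a b :=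
  intervalIntegrable_iff.mpr <|
    (hf.integrableOn_isCompact isCompact_uIcc).mono_set uIoc_subset_uIcc

theorem absolutelyContinuousOnInterval_const {X : Type*} [PseudoMetricSpace X] (c : X) (a b : ℝ) :
    AbsolutelyContinuousOnInterval (fun _ => c) a b :=
  ((LipschitzWith.const c).lipschitzOnWith (K := 0)).absolutelyContinuousOnInterval

theorem absolutelyContinuousOnInterval_integral {f : ℝ → ℂ} (hf : LocallyIntegrable f volume)
    (b : ℝ) : AbsolutelyContinuousOnInterval (fun x => ∫ t in (0 : ℝ)..x, f t) 0 b := by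
  have hi := intervalIntegrable_of_locallyIntegrable hf
  have hre : IntervalIntegrable (fun x => (f x).re) volume 0 b :=
    ⟨(hi 0 b).1.re, (hi 0 b).2.re⟩
  have him : IntervalIntegrable (fun x => (f x).im) volume 0 b :=
    ⟨(hi 0 b).1.im, (hi 0 b).2.im⟩
  have h1 := (hre.absolutelyContinuousOnInterval_intervalIntegral left_mem_uIcc).smul
    (absolutelyContinuousOnInterval_const (1 : ℂ) 0 b)
  have h2 := (him.absolutelyContinuousOnInterval_intervalIntegral left_mem_uIcc).smul
    (absolutelyContinuousOnInterval_const Complex.I 0 b)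
  refine Eq.subst (motive := fun F => AbsolutelyContinuousOnInterval F 0 b) (funext fun x => ?_)
    (h1.add h2)
  have e : ∫ t in (0 : ℝ)..x, f t = ∫ t in (0 : ℝ)..x, (((f t).re : ℂ) + (f t).im * Complex.I) := by
    simp only [Complex.re_add_im]
  have i1 : IntervalIntegrable (fun t => ((f t).re : ℂ)) volume 0 x :=
    ⟨(hi 0 x).1.re.ofReal, (hi 0 x).2.re.ofReal⟩
  have i2 : IntervalIntegrable (fun t => ((f t).im : ℂ)) volume 0 x :=
    ⟨(hi 0 x).1.im.ofReal, (hi 0 x).2.im.ofReal⟩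
  rw [e, intervalIntegral.integral_add i1 (i2.mul_const _), intervalIntegral.integral_mul_const,
    intervalIntegral.integral_ofReal, intervalIntegral.integral_ofReal]
  simp

namespace IsPrimitive

variable {F f P p : ℝ → ℂ}

theorem sub_eq (h : IsPrimitive F f) (a b : ℝ) : F b - F a = ∫ t in a..b, f t := by
  have hi := intervalIntegrable_of_locallyIntegrable h.1
  rw [h.2 b, h.2 a, ← intervalIntegral.integral_interval_sub_left (hi 0 b) (hi 0 a)]
  ring

theorem absolutelyContinuous (h : IsPrimitive F f) (b : ℝ) :
    AbsolutelyContinuousOnInterval F 0 b := by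
  have := (absolutelyContinuousOnInterval_const (F 0) 0 b).add
    (absolutelyContinuousOnInterval_integral h.1 b)
  rwa [show F = (fun _ => F 0) + fun x => ∫ t in (0 : ℝ)..x, f t from funext h.2]

theorem continuous (h : IsPrimitive F f) : Continuous F := by
  rw [show F = fun x => F 0 + ∫ t in (0 : ℝ)..x, f t from funext h.2]
  exact continuous_const.add
    (intervalIntegral.continuous_primitive (intervalIntegrable_of_locallyIntegrable h.1) 0)

theorem ae_hasDerivAt (h : IsPrimitive F f) : ∀ᵐ x, HasDerivAt F (f x) x := by
  filter_upwards [LocallyIntegrable.ae_hasDerivAt_integral h.1] with x hx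
  rw [show F = fun x => F 0 + ∫ t in (0 : ℝ)..x, f t from funext h.2]
  exact (hx 0).const_add _

/-- The difference of `F P` and the integral of the product-rule expression is absolutely continuous
with derivative zero almost everywhere, hence constant. -/
theorem mul (hF : IsPrimitive F f) (hP : IsPrimitive P p) :
    IsPrimitive (fun x => F x * P x) (fun x => f x * P x + F x * p x) := by
  have hloc : LocallyIntegrable (fun x => f x * P x + F x * p x) volume := by
    have h1 := hF.1.locallyIntegrableOn univ
    have h2 := hP.1.locallyIntegrableOn univ
    have h3 := (h1.mul_continuousOn hP.continuous.continuousOn isClosed_univ.isLocallyClosed)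
    have h4 := (h2.continuousOn_mul hF.continuous.continuousOn isClosed_univ.isLocallyClosed)
    exact (locallyIntegrableOn_univ.1 h3).add (locallyIntegrableOn_univ.1 h4)
  refine ⟨hloc, fun x => ?_⟩
  let H : ℝ → ℂ := fun y => F y * P y - ∫ t in (0 : ℝ)..y, (f t * P t + F t * p t)
  have hac : AbsolutelyContinuousOnInterval H 0 x :=
    ((hF.absolutelyContinuous x).smul (hP.absolutelyContinuous x)).sub
      (absolutelyContinuousOnInterval_integral hloc x)
  have hH : ∀ᵐ y, y ∈ uIcc 0 x → HasDerivAt H 0 y := by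
    filter_upwards [hF.ae_hasDerivAt, hP.ae_hasDerivAt,
      LocallyIntegrable.ae_hasDerivAt_integral hloc] with y h1 h2 h3 _
    have := (h1.mul h2).sub (h3 0)
    rwa [sub_self] at this
  obtain ⟨c, hc⟩ := hac.const_of_ae_hasDerivAt_zero hH
  have h0 := (hc x right_mem_uIcc).trans (hc 0 left_mem_uIcc).symm
  simp only [H, intervalIntegral.integral_same, sub_zero] at h0
  beta_reduce
  rw [← h0]
  ring

theorem star (h : IsPrimitive F f) :
    IsPrimitive (fun x => starRingEnd ℂ (F x)) (fun x => starRingEnd ℂ (f x)) := by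
  refine ⟨fun x => ?_, fun x => ?_⟩
  · obtain ⟨s, hs, hi⟩ := h.1 x
    exact ⟨s, hs, (LinearIsometryEquiv.integrable_comp_iff Complex.conjLIE).2 hi⟩
  · beta_reduce
    rw [h.2 x, map_add, intervalIntegral.intervalIntegral_eq_integral_uIoc,
      intervalIntegral.intervalIntegral_eq_integral_uIoc, integral_conj]
    split_ifs <;> simp

theorem of_contDiff {φ : ℝ → ℝ} (hφ : ContDiff ℝ ∞ φ) :
    IsPrimitive (fun x => (φ x : ℂ)) (fun x => ((deriv φ x : ℝ) : ℂ)) := by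
  have hd : Continuous (deriv φ) := hφ.continuous_deriv (by simp)
  refine ⟨(Complex.continuous_ofReal.comp hd).locallyIntegrable, fun x => ?_⟩
  rw [intervalIntegral.integral_ofReal, intervalIntegral.integral_deriv_eq_sub
    (fun y _ => (hφ.differentiable (by simp)).differentiableAt) (hd.intervalIntegrable _ _)]
  push_cast
  ring

theorem add_const (h : IsPrimitive F f) (c : ℂ) : IsPrimitive (fun x => F x + c) f :=
  ⟨h.1, fun x => by beta_reduce; rw [h.2 x]; ring⟩

open Filter Topology in
-- Integrability of `f` gives `F` a limit at `+∞`. A nonzero limit would keep `‖F‖` above a positive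
-- constant on a half-line of infinite measure, against integrability of `F`.
theorem eq_neg_integral_Ioi (h : IsPrimitive F f) (hF : Integrable F) (hf : Integrable f) (a : ℝ) :
    F a = -∫ t in Ioi a, f t := by
  have h1 : Tendsto (fun b => F a + ∫ t in a..b, f t) atTop (𝓝 (F a + ∫ t in Ioi a, f t)) :=
    tendsto_const_nhds.add (intervalIntegral_tendsto_integral_Ioi a hf.integrableOn tendsto_id)
  simp only [← h.sub_eq, add_sub_cancel] at h1
  by_contra hne
  have hL : 0 < ‖F a + ∫ t in Ioi a, f t‖ :=
    norm_pos_iff.2 fun h0 => hne (eq_neg_of_add_eq_zero_left h0)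
  have h2 := (h1.norm.eventually (lt_mem_nhds (half_lt_self hL)))
  obtain ⟨b, hb⟩ := eventually_atTop.1 h2
  have h3 := hF.measure_norm_ge_lt_top (half_pos hL)
  refine absurd (measure_mono (μ := volume) fun x (hx : x ∈ Ici b) => (hb x hx).le) ?_
  rw [Real.volume_Ici]
  exact not_le.2 h3

open Filter Topology in
theorem eq_integral_Iic (h : IsPrimitive F f) (hF : Integrable F) (hf : Integrable f) (a : ℝ) :
    F a = ∫ t in Iic a, f t := by
  have h1 : Tendsto (fun b => F a - ∫ t in b..a, f t) atBot (𝓝 (F a - ∫ t in Iic a, f t)) :=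
    tendsto_const_nhds.sub (intervalIntegral_tendsto_integral_Iic a hf.integrableOn tendsto_id)
  simp only [← h.sub_eq, sub_sub_cancel] at h1
  by_contra hne
  have hL : 0 < ‖F a - ∫ t in Iic a, f t‖ := norm_pos_iff.2 fun h0 => hne (sub_eq_zero.1 h0)
  have h2 := (h1.norm.eventually (lt_mem_nhds (half_lt_self hL)))
  obtain ⟨b, hb⟩ := eventually_atBot.1 h2
  have h3 := hF.measure_norm_ge_lt_top (half_pos hL)
  refine absurd (measure_mono (μ := volume) fun x (hx : x ∈ Iic b) => (hb x hx).le) ?_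
  rw [Real.volume_Iic]
  exact not_le.2 h3

theorem integral_eq_zero (h : IsPrimitive F f) (hF : Integrable F) (hf : Integrable f) :
    ∫ x, f x = 0 := by
  rw [← intervalIntegral.integral_Iic_add_Ioi (b := 0) hf.integrableOn hf.integrableOn,
    ← h.eq_integral_Iic hF hf, h.eq_neg_integral_Ioi hF hf 0]
  ring

theorem norm_le (h : IsPrimitive F f) (hF : Integrable F) (hf : Integrable f) (a : ℝ) :
    ‖F a‖ ≤ ∫ x, ‖f x‖ := by
  rw [h.eq_integral_Iic hF hf a]
  exact (norm_integral_le_integral_norm _).trans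
    (setIntegral_le_integral hf.norm (ae_of_all _ fun _ => norm_nonneg _))

theorem hasWeakDeriv (h : IsPrimitive F f) : HasWeakDeriv F f := by
  refine ⟨h.continuous.locallyIntegrable, h.1, fun φ hφ hc => ?_⟩
  have hd : Continuous (deriv φ) := hφ.continuous_deriv (by simp)
  have i0 := h.continuous.locallyIntegrable.integrable_smul_left_of_hasCompactSupport
    (μ := volume) hφ.continuous hc
  have i1 := h.continuous.locallyIntegrable.integrable_smul_left_of_hasCompactSupport
    (μ := volume) hd hc.deriv
  have i2 := h.1.integrable_smul_left_of_hasCompactSupport hφ.continuous hc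
  simp only [Complex.real_smul] at i0 i1 i2 ⊢
  have := ((of_contDiff hφ).mul h).integral_eq_zero i0 (i1.add i2)
  rw [integral_add i1 i2] at this
  exact eq_neg_of_add_eq_zero_left this

end IsPrimitive

/-! ### Weak derivatives and primitives -/

/-- The lemma of du Bois-Reymond. -/
theorem HasWeakDeriv.exists_ae_eq_const {f : ℝ → ℂ} (h : HasWeakDeriv f 0) :
    ∃ c : ℂ, f =ᵐ[volume] fun _ => c := by
  let χb : ContDiffBump (0 : ℝ) := ⟨1, 2, one_pos, one_lt_two⟩
  let χ : ℝ → ℝ := χb.normed volume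
  have hχ : ContDiff ℝ ∞ χ := χb.contDiff_normed
  have hχc : HasCompactSupport χ := χb.hasCompactSupport_normed
  have hχ1 : ∫ x, χ x = 1 := χb.integral_normed
  have hint : ∀ {η : ℝ → ℝ}, ContDiff ℝ ∞ η → HasCompactSupport η → Integrable fun x => η x • f x :=
    fun h1 h2 => h.1.integrable_smul_left_of_hasCompactSupport h1.continuous h2
  refine ⟨∫ x, χ x • f x, ae_eq_of_integral_contDiff_smul_eq h.1 (locallyIntegrable_const _) ?_⟩
  intro η hη hηc
  have hηi : Integrable η := hη.continuous.integrable_of_hasCompactSupport hηc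
  have hχi : Integrable χ := hχ.continuous.integrable_of_hasCompactSupport hχc
  -- Subtracting `c χ` makes the integral of `θ` vanish, which is what gives its primitive `Θ`
  -- compact support and makes `Θ` a test function.
  let c : ℝ := ∫ x, η x
  let θ : ℝ → ℝ := fun x => η x - c * χ x
  have hθ : ContDiff ℝ ∞ θ := hη.sub (contDiff_const.mul hχ)
  have hθi : Integrable θ := hηi.sub (hχi.const_mul c)
  have hθ0 : ∫ x, θ x = 0 := by
    rw [integral_sub hηi (hχi.const_mul c), integral_const_mul, hχ1, mul_one, sub_self]
  have hθc : HasCompactSupport θ := hηc.sub (hχc.mul_left)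
  let Θ : ℝ → ℝ := fun x => ∫ t in Iic x, θ t
  have hΘd : ∀ x, HasDerivAt Θ (θ x) x := by
    intro x
    have e : Θ = fun y => (∫ t in Iic (0 : ℝ), θ t) + ∫ t in (0 : ℝ)..y, θ t := by
      funext y
      rw [← intervalIntegral.integral_Iic_sub_Iic hθi.integrableOn hθi.integrableOn]
      ring
    rw [e]
    exact (intervalIntegral.integral_hasDerivAt_right (hθ.continuous.intervalIntegrable _ _)
      (hθ.continuous.stronglyMeasurableAtFilter _ _) hθ.continuous.continuousAt).const_add _
  have hΘ' : deriv Θ = θ := funext fun x => (hΘd x).deriv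
  have hΘ : ContDiff ℝ ∞ Θ := by
    rw [contDiff_infty_iff_deriv, hΘ']
    exact ⟨fun x => (hΘd x).differentiableAt, hθ⟩
  have hΘc : HasCompactSupport Θ := by
    obtain ⟨r, hr⟩ := hθc.isCompact.isBounded.subset_closedBall 0
    refine HasCompactSupport.intro (isCompact_closedBall 0 r) fun x hx => ?_
    have hz : ∀ t, r < |t| → θ t = 0 := fun t ht => by
      by_contra h0
      have := hr (subset_tsupport θ h0)
      rw [mem_closedBall_zero_iff, Real.norm_eq_abs] at this
      exact absurd this (not_le.2 ht)
    rw [mem_closedBall_zero_iff, Real.norm_eq_abs, not_le] at hx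
    rcases le_or_gt x 0 with h0 | h0
    · refine setIntegral_eq_zero_of_forall_eq_zero fun t (ht : t ≤ x) => hz t ?_
      rw [abs_of_nonpos (ht.trans h0)]
      rw [abs_of_nonpos h0] at hx
      linarith
    · have h1 : ∫ t in Ioi x, θ t = 0 := by
        refine setIntegral_eq_zero_of_forall_eq_zero fun t (ht : x < t) => hz t ?_
        rw [abs_of_pos (h0.trans ht)]
        rw [abs_of_pos h0] at hx
        linarith
      have h2 := intervalIntegral.integral_Iic_add_Ioi (b := x) hθi.integrableOn hθi.integrableOn
      rw [h1, add_zero, hθ0] at h2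
      exact h2
  have key := h.2.2 Θ hΘ hΘc
  simp only [hΘ', Pi.zero_apply, smul_zero, integral_zero, neg_zero] at key
  have e : ∀ x, θ x • f x = η x • f x - c • (χ x • f x) := fun x => by
    rw [sub_smul, mul_smul]
  simp only [e] at key
  have hs := integral_sub (hint hη hηc) ((hint hχ hχc).smul c)
  simp only [Pi.smul_apply] at hs
  rw [hs, integral_smul, sub_eq_zero] at key
  rw [key, integral_smul_const]

/-- Minus the integral of `g`, `f` has weak derivative zero, so du Bois-Reymond applies. Through
this lemma weak derivatives inherit the calculus of absolutely continuous functions. -/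
theorem HasWeakDeriv.exists_isPrimitive {f g : ℝ → ℂ} (h : HasWeakDeriv f g) :
    ∃ F, IsPrimitive F g ∧ f =ᵐ[volume] F := by
  have h0 : IsPrimitive (fun x => ∫ t in (0 : ℝ)..x, g t) g := ⟨h.2.1, fun x => by simp⟩
  have h1 : HasWeakDeriv (f + (-1 : ℂ) • fun x => ∫ t in (0 : ℝ)..x, g t) 0 := by
    convert h.add (h0.hasWeakDeriv.smul (-1)) using 1
    ext x; simp
  obtain ⟨c, hc⟩ := h1.exists_ae_eq_const
  refine ⟨_, h0.add_const c, ?_⟩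
  filter_upwards [hc] with x hx
  simp only [Pi.add_apply, Pi.smul_apply, smul_eq_mul] at hx
  rw [← hx]
  ring

/-- Functions in `H¹(ℝ)` are essentially bounded. -/
theorem HasWeakDeriv.memLp_top {f g : ℝ → ℂ} (h : HasWeakDeriv f g) (hf : MemLp f 2 volume)
    (hg : MemLp g 2 volume) : MemLp f ∞ volume := by
  obtain ⟨F, hF, hfF⟩ := h.exists_isPrimitive
  have hF2 : MemLp F 2 volume := (memLp_congr_ae hfF).1 hf
  -- `F²` and its derivative `2 F g` are integrable, so `|F|²` is bounded by the `L¹` norm of that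
  -- derivative.
  have hm := hF.mul hF
  have hb := hm.norm_le (hF2.integrable_mul hF2)
    ((hg.integrable_mul hF2).add (hF2.integrable_mul hg))
  refine memLp_top_of_bound hf.1 (Real.sqrt (∫ x, ‖g x * F x + F x * g x‖)) ?_
  filter_upwards [hfF] with x hx
  rw [hx]
  refine Real.le_sqrt_of_sq_le ?_
  rw [sq, ← norm_mul]
  exact hb x

/-- Integration by parts in `H¹(ℝ)`. -/
theorem HasWeakDeriv.integral_conj_mul {φ ψ f g : ℝ → ℂ} (h : HasWeakDeriv φ ψ)
    (hφ : MemLp φ 2 volume) (hψ : MemLp ψ 2 volume) (h' : HasWeakDeriv f g)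
    (hf : MemLp f 2 volume) (hg : MemLp g 2 volume) :
    ∫ x, starRingEnd ℂ (ψ x) * f x = -∫ x, starRingEnd ℂ (φ x) * g x := by
  obtain ⟨P, hP, hφP⟩ := h.exists_isPrimitive
  obtain ⟨F, hF, hfF⟩ := h'.exists_isPrimitive
  have hF2 : MemLp F 2 volume := (memLp_congr_ae hfF).1 hf
  have hP2 : MemLp (fun x => starRingEnd ℂ (P x)) 2 volume :=
    ((memLp_congr_ae hφP).1 hφ).star
  have hψ2 : MemLp (fun x => starRingEnd ℂ (ψ x)) 2 volume := hψ.star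
  have i1 := hψ2.integrable_mul hF2
  have i2 := hP2.integrable_mul hg
  have := (hP.star.mul hF).integral_eq_zero (hP2.integrable_mul hF2) (i1.add i2)
  have hs := integral_add i1 i2
  simp only [Pi.mul_apply] at hs
  rw [hs] at this
  have e1 : ∫ x, starRingEnd ℂ (ψ x) * f x = ∫ x, starRingEnd ℂ (ψ x) * F x :=
    integral_congr_ae (hfF.mono fun x hx => by simp only [hx])
  have e2 : ∫ x, starRingEnd ℂ (φ x) * g x = ∫ x, starRingEnd ℂ (P x) * g x :=
    integral_congr_ae (hφP.mono fun x hx => by simp only [hx])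
  rw [e1, e2]
  exact eq_neg_of_add_eq_zero_left this

/-! ### Weighted `L²` spaces -/

/-- `β` is measurable with values in `[b, B]`, where `0 < b`. -/
structure IsWeight (β : ℝ → ℝ) (b B : ℝ) : Prop where
  measurable : Measurable β
  pos : 0 < b
  le : ∀ x, b ≤ β x
  ge : ∀ x, β x ≤ B

theorem measurable_of_boundedVariationOn {β : ℝ → ℝ} (h : BoundedVariationOn β univ) :
    Measurable β := by
  obtain ⟨p, q, hp, hq, rfl⟩ := h.locallyBoundedVariationOn.exists_monotoneOn_sub_monotoneOn
  exact (monotoneOn_univ.1 hp).measurable.sub (monotoneOn_univ.1 hq).measurable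

/-- Bounded variation gives measurability and an upper bound, the positive infimum a lower one.
Common constants serve both coefficients. -/
theorem exists_isWeight {α β : ℝ → ℝ} (hα : BoundedVariationOn α univ)
    (hβ : BoundedVariationOn β univ) (hα_pos : ∀ x, 0 < α x) (hβ_pos : ∀ x, 0 < β x)
    (hα_inf : 0 < ⨅ x, α x) (hβ_inf : 0 < ⨅ x, β x) :
    ∃ b B, IsWeight α b B ∧ IsWeight β b B := by
  have hlow : ∀ {γ : ℝ → ℝ}, (∀ x, 0 < γ x) → ∀ x, ⨅ y, γ y ≤ γ x := fun h x =>
    ciInf_le ⟨0, by rintro _ ⟨y, rfl⟩; exact (h y).le⟩ x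
  have hup : ∀ {γ : ℝ → ℝ}, BoundedVariationOn γ univ → ∀ x,
      γ x ≤ γ 0 + (eVariationOn γ univ).toReal := fun h x => by
    linarith [h.sub_le (mem_univ x) (mem_univ 0)]
  refine ⟨min (⨅ x, α x) (⨅ x, β x), max (α 0 + (eVariationOn α univ).toReal)
    (β 0 + (eVariationOn β univ).toReal),
    ⟨measurable_of_boundedVariationOn hα, lt_min hα_inf hβ_inf, fun x => ?_, fun x => ?_⟩,
    ⟨measurable_of_boundedVariationOn hβ, lt_min hα_inf hβ_inf, fun x => ?_, fun x => ?_⟩⟩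
  · exact (min_le_left _ _).trans (hlow hα_pos x)
  · exact (hup hα x).trans (le_max_left _ _)
  · exact (min_le_right _ _).trans (hlow hβ_pos x)
  · exact (hup hβ x).trans (le_max_right _ _)

namespace IsWeight

variable {β : ℝ → ℝ} {b B : ℝ}

theorem pos' (h : IsWeight β b B) (x : ℝ) : 0 < β x := h.pos.trans_le (h.le x)

theorem ne_zero (h : IsWeight β b B) (x : ℝ) : (β x : ℂ) ≠ 0 := by
  exact_mod_cast (h.pos' x).ne'

theorem measurable_ofReal (h : IsWeight β b B) : Measurable fun x => (β x : ℂ) :=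
  Complex.measurable_ofReal.comp h.measurable

theorem weight_le (h : IsWeight β b B) : weight β ≤ ENNReal.ofReal B • volume := by
  rw [← withDensity_const]
  exact withDensity_mono (ae_of_all _ fun x => ENNReal.ofReal_le_ofReal (h.ge x))

theorem le_weight (h : IsWeight β b B) : ENNReal.ofReal b • volume ≤ weight β := by
  rw [← withDensity_const]
  exact withDensity_mono (ae_of_all _ fun x => ENNReal.ofReal_le_ofReal (h.le x))

theorem ae_weight (h : IsWeight β b B) : ae (weight β) = ae volume := by
  refine le_antisymm (withDensity_absolutelyContinuous _ _).ae_le ?_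
  exact (withDensity_absolutelyContinuous' h.measurable.aemeasurable.ennreal_ofReal
    (ae_of_all _ fun x => by simp [h.pos' x])).ae_le

theorem ae_eq_iff (h : IsWeight β b B) {f g : ℝ → ℂ} :
    f =ᵐ[weight β] g ↔ f =ᵐ[volume] g := by
  rw [Filter.EventuallyEq, h.ae_weight, Filter.EventuallyEq]

theorem memLp_iff (h : IsWeight β b B) {f : ℝ → ℂ} :
    MemLp f 2 (weight β) ↔ MemLp f 2 volume := by
  refine ⟨fun hf => hf.of_measure_le_smul (c := (ENNReal.ofReal b)⁻¹) ?_ ?_,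
    fun hf => hf.of_measure_le_smul ENNReal.ofReal_ne_top h.weight_le⟩
  · simp [h.pos]
  · refine Measure.le_iff.2 fun s hs => ?_
    have := Measure.le_iff.1 h.le_weight s hs
    rw [Measure.smul_apply, smul_eq_mul] at this ⊢
    rw [mul_comm, ← div_eq_mul_inv, ENNReal.le_div_iff_mul_le (by simp [h.pos]) (by simp), mul_comm]
    exact this

theorem memLp_coe (h : IsWeight β b B) (u : WeightedL2 β) : MemLp u 2 volume :=
  h.memLp_iff.1 (Lp.memLp u)

theorem locallyIntegrable_coe (h : IsWeight β b B) (u : WeightedL2 β) :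
    LocallyIntegrable u volume :=
  (h.memLp_coe u).locallyIntegrable (by norm_num)

theorem coeFn_toLp (h : IsWeight β b B) {f : ℝ → ℂ} (hf : MemLp f 2 (weight β)) :
    hf.toLp f =ᵐ[volume] f :=
  h.ae_eq_iff.1 hf.coeFn_toLp

theorem memLp_mul (h : IsWeight β b B) {f : ℝ → ℂ} (hf : MemLp f 2 volume) :
    MemLp (fun x => (β x : ℂ) * f x) 2 volume := by
  refine hf.of_le_mul (c := B) (h.measurable_ofReal.aestronglyMeasurable.mul hf.1)
    (ae_of_all _ fun x => ?_)
  rw [norm_mul, Complex.norm_real, Real.norm_of_nonneg (h.pos' x).le]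
  gcongr
  exact h.ge x

theorem memLp_of_mul (h : IsWeight β b B) {f : ℝ → ℂ} {p : ℝ≥0∞}
    (hf : MemLp (fun x => (β x : ℂ) * f x) p volume) : MemLp f p volume := by
  have e : f = fun x => (β x : ℂ)⁻¹ * ((β x : ℂ) * f x) := by
    funext x
    rw [inv_mul_cancel_left₀ (h.ne_zero x)]
  refine hf.of_le_mul (c := b⁻¹) ?_ (ae_of_all _ fun x => ?_)
  · rw [e]
    exact h.measurable_ofReal.inv.aestronglyMeasurable.mul hf.1
  · rw [norm_mul, Complex.norm_real, Real.norm_of_nonneg (h.pos' x).le, ← mul_assoc]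
    refine le_mul_of_one_le_left (norm_nonneg _) ?_
    rw [inv_mul_eq_div, one_le_div h.pos]
    exact h.le x

theorem inner_eq (h : IsWeight β b B) {u v : WeightedL2 β} {f g : ℝ → ℂ}
    (hu : u =ᵐ[volume] f) (hv : v =ᵐ[volume] g) :
    inner ℂ u v = ∫ x, starRingEnd ℂ (f x) * ((β x : ℂ) * g x) := by
  rw [L2.inner_def]
  refine (integral_withDensity_eq_integral_toReal_smul
    h.measurable.ennreal_ofReal (ae_of_all _ fun x => ENNReal.ofReal_lt_top) _).trans
    (integral_congr_ae ?_)
  filter_upwards [hu, hv] with x hx hx'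
  rw [hx, hx', RCLike.inner_apply, ENNReal.toReal_ofReal (h.pos' x).le, Complex.real_smul]
  ring

theorem norm_sq_le (h : IsWeight β b B) {u : WeightedL2 β} {f : ℝ → ℂ} (hu : u =ᵐ[volume] f)
    (hf : MemLp f 2 volume) : ‖u‖ ^ 2 ≤ B * (eLpNorm f 2 volume).toReal ^ 2 := by
  have hB : 0 ≤ B := (h.pos' 0).le.trans (h.ge 0)
  have h1 : eLpNorm u 2 (weight β) = eLpNorm f 2 (weight β) := eLpNorm_congr_ae (h.ae_eq_iff.2 hu)
  have h2 := eLpNorm_mono_measure (p := 2) f h.weight_le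
  rw [eLpNorm_smul_measure_of_ne_top (by norm_num), smul_eq_mul] at h2
  have h3 := ENNReal.toReal_mono (ENNReal.mul_ne_top
    (ENNReal.rpow_ne_top_of_nonneg (by norm_num) ENNReal.ofReal_ne_top) hf.2.ne) h2
  rw [ENNReal.toReal_mul, ← ENNReal.toReal_rpow, ENNReal.toReal_ofReal hB] at h3
  rw [Lp.norm_def, h1]
  calc _ ≤ (B ^ (1 / 2 : ℝ≥0∞).toReal * (eLpNorm f 2 volume).toReal) ^ 2 := by gcongr
    _ = _ := by
      rw [mul_pow, ← Real.rpow_natCast (B ^ _), ← Real.rpow_mul hB]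
      norm_num

theorem le_norm_sq (h : IsWeight β b B) {u : WeightedL2 β} {f : ℝ → ℂ} (hu : u =ᵐ[volume] f)
    (hf : MemLp f 2 volume) : b * (eLpNorm f 2 volume).toReal ^ 2 ≤ ‖u‖ ^ 2 := by
  have h1 : eLpNorm u 2 (weight β) = eLpNorm f 2 (weight β) := eLpNorm_congr_ae (h.ae_eq_iff.2 hu)
  have h2 := eLpNorm_mono_measure (p := 2) f h.le_weight
  rw [eLpNorm_smul_measure_of_ne_top (by norm_num), smul_eq_mul] at h2
  have h3 := ENNReal.toReal_mono (h.memLp_iff.2 hf).2.ne h2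
  rw [ENNReal.toReal_mul, ← ENNReal.toReal_rpow, ENNReal.toReal_ofReal h.pos.le] at h3
  rw [Lp.norm_def, h1]
  calc _ = (b ^ (1 / 2 : ℝ≥0∞).toReal * (eLpNorm f 2 volume).toReal) ^ 2 := by
        rw [mul_pow, ← Real.rpow_natCast (b ^ _), ← Real.rpow_mul h.pos.le]
        norm_num
    _ ≤ _ := by
        have := Real.rpow_nonneg h.pos.le (1 / 2 : ℝ≥0∞).toReal
        gcongr

/-- Integration against a continuous function with compact support is an inner product. -/
theorem exists_inner_eq (h : IsWeight β b B) {ψ : ℝ → ℝ} (hψ : Continuous ψ)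
    (hc : HasCompactSupport ψ) :
    ∃ e : WeightedL2 β, ∀ u : WeightedL2 β, inner ℂ e u = ∫ x, ψ x • u x := by
  have h1 : MemLp (fun x => (ψ x : ℂ)) 2 volume :=
    (Complex.continuous_ofReal.comp hψ).memLp_of_hasCompactSupport
      (hc.comp_left (g := fun x : ℝ => (x : ℂ)) Complex.ofReal_zero)
  -- The factor `β⁻¹` cancels the weight in the inner product.
  have h2 : MemLp (fun x => (β x : ℂ)⁻¹ * (ψ x : ℂ)) 2 volume := h.memLp_of_mul <| by
    convert h1 using 1
    funext x
    rw [mul_inv_cancel_left₀ (h.ne_zero x)]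
  refine ⟨(h.memLp_iff.2 h2).toLp _, fun u => ?_⟩
  rw [h.inner_eq (h.coeFn_toLp _) Filter.EventuallyEq.rfl]
  refine integral_congr_ae (ae_of_all _ fun x => ?_)
  have := h.ne_zero x
  simp only [map_mul, map_inv₀, Complex.conj_ofReal, Complex.real_smul]
  field_simp

end IsWeight

/-! ### The form domain as a Hilbert space -/

/-- The space `H¹(ℝ)`, as the set of pairs `(u, ∂ₓu)`, with the inner product
`⟨u, v⟩ + ∫ α ∂ₓu̅ ∂ₓv`. -/
def formGraph {α β : ℝ → ℝ} {b B : ℝ} (hα : IsWeight α b B) (hβ : IsWeight β b B) :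
    Submodule ℂ (WithLp 2 (WeightedL2 β × WeightedL2 α)) where
  carrier := {p | HasWeakDeriv p.fst p.snd}
  zero_mem' := by
    refine HasWeakDeriv.zero.congr_ae ?_ ?_
    · exact (hβ.ae_eq_iff.1 (Lp.coeFn_zero ℂ 2 (weight β))).symm
    · exact (hα.ae_eq_iff.1 (Lp.coeFn_zero ℂ 2 (weight α))).symm
  add_mem' := by
    intro p q hp hq
    refine (HasWeakDeriv.add hp hq).congr_ae ?_ ?_
    · exact (hβ.ae_eq_iff.1 (Lp.coeFn_add p.fst q.fst)).symm
    · exact (hα.ae_eq_iff.1 (Lp.coeFn_add p.snd q.snd)).symm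
  smul_mem' := by
    intro c p hp
    refine (HasWeakDeriv.smul c hp).congr_ae ?_ ?_
    · exact (hβ.ae_eq_iff.1 (Lp.coeFn_smul c p.fst)).symm
    · exact (hα.ae_eq_iff.1 (Lp.coeFn_smul c p.snd)).symm

section FormGraph

variable {α β : ℝ → ℝ} {b B : ℝ} (hα : IsWeight α b B) (hβ : IsWeight β b B)

theorem mem_formGraph (p : WithLp 2 (WeightedL2 β × WeightedL2 α)) :
    p ∈ formGraph hα hβ ↔ HasWeakDeriv p.fst p.snd := Iff.rfl

/-- Each test function imposes an equation between inner products with fixed vectors, a closed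
condition. Closedness makes the form domain a Hilbert space. -/
theorem isClosed_formGraph :
    IsClosed (formGraph hα hβ : Set (WithLp 2 (WeightedL2 β × WeightedL2 α))) := by
  have e : (formGraph hα hβ : Set (WithLp 2 (WeightedL2 β × WeightedL2 α))) =
      ⋂ (φ : ℝ → ℝ) (_ : ContDiff ℝ ∞ φ) (_ : HasCompactSupport φ),
        {p | ∫ x, deriv φ x • p.fst x = -∫ x, φ x • p.snd x} := by
    ext p
    simp only [SetLike.mem_coe, mem_formGraph, mem_iInter, mem_ofPred_eq]
    exact ⟨fun h => h.2.2, fun h => ⟨hβ.locallyIntegrable_coe _, hα.locallyIntegrable_coe _, h⟩⟩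
  rw [e]
  refine isClosed_iInter fun φ => isClosed_iInter fun hφ => isClosed_iInter fun hc => ?_
  have hd : Continuous (deriv φ) := hφ.continuous_deriv (by simp)
  obtain ⟨e1, he1⟩ := hβ.exists_inner_eq hd hc.deriv
  obtain ⟨e2, he2⟩ := hα.exists_inner_eq hφ.continuous hc
  simp only [← he1, ← he2]
  have c1 : Continuous fun p : WithLp 2 (WeightedL2 β × WeightedL2 α) => p.fst :=
    (WithLp.fstL 2 ℂ (WeightedL2 β) (WeightedL2 α)).continuous
  have c2 : Continuous fun p : WithLp 2 (WeightedL2 β × WeightedL2 α) => p.snd :=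
    (WithLp.sndL 2 ℂ (WeightedL2 β) (WeightedL2 α)).continuous
  exact isClosed_eq (continuous_const.inner c1) (continuous_const.inner c2).neg

instance : CompleteSpace (formGraph hα hβ) := (isClosed_formGraph hα hβ).completeSpace_coe

/-- The embedding of `H¹(ℝ)` into `L²(ℝ; β dx)`. -/
def formEmbedding : formGraph hα hβ →L[ℂ] WeightedL2 β :=
  WithLp.fstL 2 ℂ (WeightedL2 β) (WeightedL2 α) ∘L (formGraph hα hβ).subtypeL

theorem formEmbedding_apply (p : formGraph hα hβ) : formEmbedding hα hβ p = p.1.fst := rfl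

/-- The element of the form domain given by a function in `H¹(ℝ)`. -/
theorem exists_formGraph {f g : ℝ → ℂ} (h : HasWeakDeriv f g) (hf : MemLp f 2 volume)
    (hg : MemLp g 2 volume) :
    ∃ p : formGraph hα hβ, p.1.fst =ᵐ[volume] f ∧ p.1.snd =ᵐ[volume] g := by
  have h1 := hβ.coeFn_toLp (hβ.memLp_iff.2 hf)
  have h2 := hα.coeFn_toLp (hα.memLp_iff.2 hg)
  exact ⟨⟨WithLp.toLp 2 ((hβ.memLp_iff.2 hf).toLp f, (hα.memLp_iff.2 hg).toLp g),
    h.congr_ae h1.symm h2.symm⟩, h1, h2⟩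

theorem exists_formGraph_of_contDiff {φ : ℝ → ℝ} (hφ : ContDiff ℝ ∞ φ)
    (hc : HasCompactSupport φ) :
    ∃ p : formGraph hα hβ, p.1.fst =ᵐ[volume] (fun x => (φ x : ℂ)) ∧
      p.1.snd =ᵐ[volume] (fun x => ((deriv φ x : ℝ) : ℂ)) := by
  have hd : Continuous (deriv φ) := hφ.continuous_deriv (by simp)
  refine exists_formGraph hα hβ (IsPrimitive.of_contDiff hφ).hasWeakDeriv ?_ ?_
  · exact (Complex.continuous_ofReal.comp hφ.continuous).memLp_of_hasCompactSupport
      (hc.comp_left (g := fun x : ℝ => (x : ℂ)) Complex.ofReal_zero)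
  · exact (Complex.continuous_ofReal.comp hd).memLp_of_hasCompactSupport
      (hc.deriv.comp_left (g := fun x : ℝ => (x : ℂ)) Complex.ofReal_zero)

theorem weightedL2_ext {γ : ℝ → ℝ} (hγ : IsWeight γ b B) {u v : WeightedL2 γ}
    (h : u =ᵐ[volume] v) : u = v :=
  Lp.ext (hγ.ae_eq_iff.2 h)

theorem weightedL2_coeFn_zero {γ : ℝ → ℝ} (hγ : IsWeight γ b B) :
    (0 : WeightedL2 γ) =ᵐ[volume] (0 : ℝ → ℂ) :=
  hγ.ae_eq_iff.1 (Lp.coeFn_zero ℂ 2 (weight γ))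

theorem formEmbedding_injective : Function.Injective (formEmbedding hα hβ) := by
  refine (injective_iff_map_eq_zero _).2 fun p hp => ?_
  rw [formEmbedding_apply] at hp
  have hp' : HasWeakDeriv p.1.fst p.1.snd := p.2
  have h1 : p.1.fst =ᵐ[volume] (0 : ℝ → ℂ) := by rw [hp]; exact weightedL2_coeFn_zero hβ
  have h2 := (hp'.congr_ae h1 Filter.EventuallyEq.rfl).unique HasWeakDeriv.zero
  have h3 : p.1.snd = 0 := weightedL2_ext hα (h2.trans (weightedL2_coeFn_zero hα).symm)
  refine Subtype.ext ((WithLp.ofLp_injective 2) (Prod.ext hp h3))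

theorem norm_sq_formGraph (p : formGraph hα hβ) : ‖p‖ ^ 2 = ‖p.1.fst‖ ^ 2 + ‖p.1.snd‖ ^ 2 :=
  WithLp.prod_norm_sq_eq_of_L2 p.1

theorem norm_formEmbedding_le (p : formGraph hα hβ) : ‖formEmbedding hα hβ p‖ ≤ ‖p‖ := by
  refine le_of_sq_le_sq ?_ (norm_nonneg _)
  rw [norm_sq_formGraph, formEmbedding_apply]
  exact le_add_of_nonneg_right (sq_nonneg _)

/-- A vector `u` orthogonal to all test functions has `β u = 0` almost everywhere. -/
theorem denseRange_formEmbedding : DenseRange (formEmbedding hα hβ) := by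
  refine denseRange_of_orthogonal (L := (formEmbedding hα hβ : formGraph hα hβ →ₗ[ℂ] WeightedL2 β))
    fun u hu => ?_
  have h1 : LocallyIntegrable (fun x => (β x : ℂ) * u x) volume :=
    (hβ.memLp_mul (hβ.memLp_coe u)).locallyIntegrable (by norm_num)
  have h2 := ae_eq_zero_of_integral_contDiff_smul_eq_zero h1 fun φ hφ hc => by
    obtain ⟨p, hp, -⟩ := exists_formGraph_of_contDiff hα hβ hφ hc
    have := (hβ.inner_eq hp (v := u) Filter.EventuallyEq.rfl).symm.trans (hu p)
    simpa only [Complex.conj_ofReal, Complex.real_smul] using this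
  refine weightedL2_ext hβ (Filter.EventuallyEq.trans ?_ (weightedL2_coeFn_zero hβ).symm)
  filter_upwards [h2] with x hx
  exact (mul_eq_zero.1 hx).resolve_left (hβ.ne_zero x)

/-! ### `H` as the operator of the form, and the comparison of norms -/

theorem inner_formGraph (p q : formGraph hα hβ) :
    inner ℂ p q = inner ℂ p.1.fst q.1.fst + inner ℂ p.1.snd q.1.snd :=
  WithLp.prod_inner_apply p.1 q.1

/-- By definition of the adjoint, the right-hand side says that `u` is in `H¹(ℝ)` and `∫ α q̄' u' =
∫ β q̄ w` for all `q` in `H¹(ℝ)`: the weak form of `H u = w`. -/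
theorem mem_waveGraph_iff (u w : WeightedL2 β) :
    (u, w) ∈ waveGraph α β ↔
      u = formEmbedding hα hβ ((formEmbedding hα hβ).adjoint (u + w)) := by
  constructor
  · rintro ⟨f, v, g, hu, hf, -, hfv, hv, -, hvg, hg, hw⟩
    rw [hβ.ae_eq_iff] at hu hw
    obtain ⟨p, hp1, hp2⟩ := exists_formGraph hα hβ hfv hf hv
    have hpu : p.1.fst = u := weightedL2_ext hβ (hp1.trans hu.symm)
    have : (formEmbedding hα hβ).adjoint (u + w) = p := by
      refine ext_inner_left ℂ fun q => ?_
      rw [ContinuousLinearMap.adjoint_inner_right, inner_formGraph, formEmbedding_apply,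
        inner_add_right, hpu, hβ.inner_eq Filter.EventuallyEq.rfl hw,
        hα.inner_eq Filter.EventuallyEq.rfl hp2]
      have hq : HasWeakDeriv q.1.fst q.1.snd := q.2
      -- Both `q` and `α v` are in `H¹(ℝ)`, so no boundary terms appear.
      rw [hq.integral_conj_mul (hβ.memLp_coe _) (hα.memLp_coe _) hvg (hα.memLp_mul hv) hg,
        ← integral_neg]
      congr 2
      funext x
      have := hβ.ne_zero x
      field_simp
    rw [this, formEmbedding_apply, hpu]
  · intro h
    obtain ⟨p, hp⟩ : ∃ p, p = (formEmbedding hα hβ).adjoint (u + w) := ⟨_, rfl⟩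
    rw [← hp, formEmbedding_apply] at h
    have key : ∀ q : formGraph hα hβ, inner ℂ q.1.snd p.1.snd = inner ℂ q.1.fst w := by
      intro q
      have := ContinuousLinearMap.adjoint_inner_right (formEmbedding hα hβ) q (u + w)
      rw [← hp, inner_formGraph, formEmbedding_apply, inner_add_right, ← h] at this
      exact add_left_cancel this
    have hd : HasWeakDeriv p.1.fst p.1.snd := p.2
    rw [← h] at hd
    have hm1 := hα.memLp_mul (hα.memLp_coe p.1.snd)
    have hm2 : MemLp (fun x => -((β x : ℂ) * w x)) 2 volume := (hβ.memLp_mul (hβ.memLp_coe w)).neg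
    -- Smooth compactly supported `q` already identify `∂ₓ(α ∂ₓu)` as `-β w`.
    have hd2 : HasWeakDeriv (fun x => (α x : ℂ) * p.1.snd x) (fun x => -((β x : ℂ) * w x)) := by
      refine ⟨hm1.locallyIntegrable (by norm_num), hm2.locallyIntegrable (by norm_num),
        fun φ hφ hc => ?_⟩
      obtain ⟨q, hq1, hq2⟩ := exists_formGraph_of_contDiff hα hβ hφ hc
      have := key q
      rw [hα.inner_eq hq2 Filter.EventuallyEq.rfl, hβ.inner_eq hq1 Filter.EventuallyEq.rfl] at this
      simp only [Complex.conj_ofReal] at this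
      simp only [Complex.real_smul, mul_neg, integral_neg, neg_neg]
      exact this
    refine ⟨u, p.1.snd, _, Filter.EventuallyEq.rfl, hβ.memLp_coe u,
      hd.memLp_top (hβ.memLp_coe u) (hα.memLp_coe _), hd, hα.memLp_coe _,
      -- `α ∂ₓu` is bounded as an element of `H¹(ℝ)`, and dividing by `α ≥ b` keeps it bounded.
      hα.memLp_of_mul (hd2.memLp_top hm1 hm2), hd2, hm2, ae_of_all _ fun x => ?_⟩
    beta_reduce
    rw [mul_neg, neg_neg, inv_mul_cancel_left₀ (hβ.ne_zero x)]

theorem exists_formEmbedding_eq_iff (f : ℝ → ℂ) :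
    (∃ hf : MemLp f 2 (weight β), ∃ p, formEmbedding hα hβ p = hf.toLp f) ↔ MemH1 f := by
  constructor
  · rintro ⟨hf, p, hp⟩
    rw [formEmbedding_apply] at hp
    have hd : HasWeakDeriv p.1.fst p.1.snd := p.2
    rw [hp] at hd
    exact ⟨hβ.memLp_iff.1 hf, _, hd.congr_ae (hβ.coeFn_toLp hf) Filter.EventuallyEq.rfl,
      hα.memLp_coe _⟩
  · rintro ⟨hf, g, hfg, hg⟩
    obtain ⟨p, hp, -⟩ := exists_formGraph hα hβ hfg hf hg
    exact ⟨hβ.memLp_iff.2 hf, p, weightedL2_ext hβ (hp.trans (hβ.coeFn_toLp _).symm)⟩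

theorem norm_formGraph_bounds {f : ℝ → ℂ} {p : formGraph hα hβ} (hp : p.1.fst =ᵐ[volume] f) :
    Real.sqrt b * h1Norm f ≤ ‖p‖ ∧ ‖p‖ ≤ Real.sqrt B * h1Norm f := by
  have hd : HasWeakDeriv f p.1.snd := HasWeakDeriv.congr_ae p.2 hp Filter.EventuallyEq.rfl
  have hs : p.1.snd =ᵐ[volume] weakDeriv f := hd.weakDeriv_ae_eq.symm
  have hf : MemLp f 2 volume := (memLp_congr_ae hp).1 (hβ.memLp_coe _)
  have hg : MemLp (weakDeriv f) 2 volume := (memLp_congr_ae hs).1 (hα.memLp_coe _)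
  have hB : 0 ≤ B := (hβ.pos' 0).le.trans (hβ.ge 0)
  have h1 := hβ.le_norm_sq hp hf
  have h2 := hα.le_norm_sq hs hg
  have h3 := hβ.norm_sq_le hp hf
  have h4 := hα.norm_sq_le hs hg
  rw [h1Norm, ← Real.sqrt_mul hβ.pos.le, ← Real.sqrt_mul hB, mul_add, mul_add]
  constructor
  · refine Real.sqrt_le_iff.2 ⟨norm_nonneg _, ?_⟩
    rw [norm_sq_formGraph]
    exact add_le_add h1 h2
  · refine Real.le_sqrt_of_sq_le ?_
    rw [norm_sq_formGraph]
    exact add_le_add h3 h4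

end FormGraph

theorem opSqrt_eq {E : Type*} [NormedAddCommGroup E] [InnerProductSpace ℂ E] [CompleteSpace E]
    {T A : E →ₗ.[ℂ] E} (hA : IsNonnegSqrt T A) (huniq : ∀ A', IsNonnegSqrt T A' → A' = A) :
    opSqrt T = A := by
  have h : ∃ A, IsNonnegSqrt T A := ⟨A, hA⟩
  rw [opSqrt, dif_pos h]
  exact huniq _ h.choose_spec

end BVWave

end

theorem mainTheorem6 (α β : ℝ → ℝ)
    (hα_bv : BoundedVariationOn α Set.univ) (hβ_bv : BoundedVariationOn β Set.univ)
    (hα_pos : ∀ x, 0 < α x) (hβ_pos : ∀ x, 0 < β x)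
    (hα_inf : 0 < ⨅ x, α x) (hβ_inf : 0 < ⨅ x, β x)
    (R₀ α₀ β₀ : ℝ) (hR₀ : 0 < R₀) (hα₀ : 0 < α₀) (hβ₀ : 0 < β₀)
    (hα_ext : ∀ x, R₀ ≤ |x| → α x = α₀) (hβ_ext : ∀ x, R₀ ≤ |x| → β x = β₀) :
    -- the square root of `H` exists and is unique
    (BVWave.IsNonnegSqrt (BVWave.waveOp α β) (BVWave.opSqrt (BVWave.waveOp α β)) ∧
      ∀ A, BVWave.IsNonnegSqrt (BVWave.waveOp α β) A → A = BVWave.opSqrt (BVWave.waveOp α β)) ∧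
    -- its domain is `H¹(ℝ)`
    (∀ f : ℝ → ℂ,
      (∃ hf : MemLp f 2 (BVWave.weight β),
        hf.toLp f ∈ (BVWave.opSqrt (BVWave.waveOp α β)).domain) ↔ BVWave.MemH1 f) ∧
    -- and its graph norm is equivalent to the norm of `H¹(ℝ)`
    ∃ c C : ℝ, 0 < c ∧ 0 < C ∧
      ∀ (f : ℝ → ℂ) (hf : MemLp f 2 (BVWave.weight β))
        (hD : hf.toLp f ∈ (BVWave.opSqrt (BVWave.waveOp α β)).domain),
        c * BVWave.h1Norm f ≤
            BVWave.graphNorm (BVWave.opSqrt (BVWave.waveOp α β)) ⟨hf.toLp f, hD⟩ ∧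
          BVWave.graphNorm (BVWave.opSqrt (BVWave.waveOp α β)) ⟨hf.toLp f, hD⟩ ≤
            C * BVWave.h1Norm f := by

  obtain ⟨b, B, hα, hβ⟩ :=
    BVWave.exists_isWeight hα_bv hβ_bv hα_pos hβ_pos hα_inf hβ_inf
  obtain ⟨A, hA, huniq, hdom, hnorm⟩ := BVWave.exists_isNonnegSqrt (BVWave.formEmbedding hα hβ)
    (BVWave.formEmbedding_injective hα hβ) (BVWave.denseRange_formEmbedding hα hβ)
    (BVWave.norm_formEmbedding_le hα hβ) (T := BVWave.waveOp α β) fun u w => by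
      rw [BVWave.waveOp_graph α β hβ.measurable.aemeasurable hβ_pos]
      exact BVWave.mem_waveGraph_iff hα hβ u w
  rw [BVWave.opSqrt_eq hA huniq]
  -- The graph norm is the form norm, whose square lies between `b` and `B` times the squared `H¹`
  -- norm.
  refine ⟨⟨hA, huniq⟩, fun f => ?_, Real.sqrt b, Real.sqrt B, Real.sqrt_pos.2 hβ.pos,
    Real.sqrt_pos.2 ((hβ.pos' 0).trans_le (hβ.ge 0)), fun f hf hD => ?_⟩
  · rw [← BVWave.exists_formEmbedding_eq_iff hα hβ f]
    simp only [hdom]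
  · obtain ⟨p, hp⟩ := (hdom _).1 hD
    have hpf : p.1.fst =ᵐ[volume] f := by
      rw [← BVWave.formEmbedding_apply, hp]
      exact hβ.coeFn_toLp hf
    have hn := hnorm p (by rwa [hp])
    simp only [hp] at hn
    rw [hn]
    exact BVWave.norm_formGraph_bounds hα hβ hpf
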